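/- For an algebraic integer $\alpha$ contained in some cyclotomic field, let $\mathfrak m(\alpha)$ denote the mean (average) of the conjugates over $\mathbb Q$ of the algebraic number $|\alpha|^2$. Let $G$ be a finite group, let $\chi\in\mathrm{Irr}(G)$ be an irreducible complex character of $G$, and let $g\in G$ be an element whose order is a power of a prime $p$. If $p=2$ or $\chi(1)\not\equiv\pm2\pmod p$, then $\chi(g)=0$, or $\chi(g)$ is a root of unity, or $\mathfrak m(\chi(g))\ge 2$. -/

import Mathlib

/-- `Irr(G)`: the characters of the irreducible complex representations of `G`.  Every
finite-dimensional complex representation is isomorphic to one on `ℂⁿ` for some `n`. -/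
def Irr (G : Type*) [Group G] : Set (G → ℂ) :=
  {χ | ∃ (n : ℕ) (ρ : Representation ℂ G (Fin n → ℂ)), ρ.IsIrreducible ∧ χ = ρ.character}

/-- The conjugates over `ℚ` of an algebraic number `β`: the complex roots of its minimal
polynomial over `ℚ` (each of multiplicity one). -/
noncomputable def conjugates (β : ℂ) : Multiset ℂ :=
  (minpoly ℚ β).aroots ℂ

/-- `m(α)`: the mean of the conjugates of `|α|²`.  The mean is a rational number, see
`ofReal_conjMean`, so taking the real part only changes its type. -/
noncomputable def conjMean (α : ℂ) : ℝ :=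
  ((conjugates ((‖α‖ ^ 2 : ℝ) : ℂ)).sum / (conjugates ((‖α‖ ^ 2 : ℝ) : ℂ)).card).re

theorem ofReal_conjMean (α : ℂ) :
    (conjMean α : ℂ) =
      (conjugates ((‖α‖ ^ 2 : ℝ) : ℂ)).sum / (conjugates ((‖α‖ ^ 2 : ℝ) : ℂ)).card := by
  have key : ∀ β : ℂ, ∃ q : ℚ, (conjugates β).sum = (q : ℂ) := by
    intro β
    by_cases hβ : IsIntegral ℚ β
    · refine ⟨-(minpoly ℚ β).nextCoeff, ?_⟩
      have hm := (minpoly.monic hβ).map (algebraMap ℚ ℂ)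
      have h := (IsAlgClosed.splits ((minpoly ℚ β).map (algebraMap ℚ ℂ)))
        |>.nextCoeff_eq_neg_sum_roots_of_monic hm
      rw [Polynomial.nextCoeff_map (algebraMap ℚ ℂ).injective] at h
      have h2 : (conjugates β).sum = -(algebraMap ℚ ℂ (minpoly ℚ β).nextCoeff) := by
        rw [h, neg_neg]; rfl
      rw [h2]; simp
    · exact ⟨0, by simp [conjugates, minpoly.eq_zero hβ]⟩
  obtain ⟨q, hq⟩ := key ((‖α‖ ^ 2 : ℝ) : ℂ)
  unfold conjMean
  rw [hq]
  generalize (conjugates ((‖α‖ ^ 2 : ℝ) : ℂ)).card = c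
  have : ((q : ℂ) / (c : ℂ)) = (((q : ℝ) / (c : ℝ) : ℝ) : ℂ) := by push_cast; rfl
  rw [this, Complex.ofReal_re]

/-!
Write `χ(g) = ∑ cᵢ ζⁱ` with `ζ` a primitive root of unity of order `pᵐ⁺¹` and `∑ cᵢ = χ(1)`, and
split `c` into the `pᵐ` rows `(c_{r + pᵐ k})_{k < p}`.  The primitive `pᵐ⁺¹`-th roots of unity are
those that are not `pᵐ`-th roots of unity, so applying Parseval's identity to both groups of roots
of unity gives `(p - 1) 𝔪(χ(g)) = ∑ᵣ spread(row r)`.  Constant rows contribute nothing to `χ(g)` and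
any other row has spread at least `p - 1`; hence if `𝔪(χ(g)) < 2`, at most one row is not constant.
Up to a constant, that row is zero or `±1` at a single place, so that `χ(g)` is zero or a root of
unity, or else its sum is `±2` and `χ(1) ≡ ±2 (mod p)`.
-/

open Finset Polynomial Module

section Spread

variable {ι κ : Type*} [Fintype ι] [Fintype κ]

/-- The spread `n ∑ᵢ bᵢ² - (∑ᵢ bᵢ)²` of an integer vector of length `n`, that is `n²` times its
variance.  It is integral and invariant under translation, and for `ω` of prime order `n` it
equals `(n - 1) 𝔪(∑ᵢ bᵢ ωⁱ)`. -/
def spread (b : ι → ℤ) : ℤ :=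
  Fintype.card ι * ∑ i, b i ^ 2 - (∑ i, b i) ^ 2

theorem spread_add_const (b : ι → ℤ) (t : ℤ) : spread (b + Function.const ι t) = spread b := by
  simp only [spread, Pi.add_apply, Function.const_apply, add_sq, sum_add_distrib, sum_const,
    card_univ, nsmul_eq_mul, ← sum_mul, ← mul_sum]
  ring

theorem spread_nonneg (b : ι → ℤ) : 0 ≤ spread b :=
  sub_nonneg.2 sq_sum_le_card_mul_sum_sq

theorem abs_sum_le_sum_sq (b : ι → ℤ) : |∑ i, b i| ≤ ∑ i, b i ^ 2 :=
  (abs_sum_le_sum_abs _ _).trans <| sum_le_sum fun i _ => by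
    rw [← sq_abs]
    exact Int.le_self_sq |b i|

theorem even_sum_sq_sub_sum (b : ι → ℤ) : Even (∑ i, b i ^ 2 - ∑ i, b i) := by
  rw [← sum_sub_distrib]
  refine even_sum _ fun i _ => ?_
  rw [sq, ← mul_sub_one]
  exact Int.even_mul_pred_self (b i)

theorem abs_sum_mul_card_sub_abs_sum_le_spread (b : ι → ℤ) :
    |∑ i, b i| * (Fintype.card ι - |∑ i, b i|) ≤ spread b := by
  have h := mul_le_mul_of_nonneg_left (abs_sum_le_sum_sq b) (Int.natCast_nonneg (Fintype.card ι))
  rw [spread, ← sq_abs (∑ i, b i)]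
  linarith

theorem exists_eq_add_const_two_mul_abs_sum_le (b : ι → ℤ) :
    ∃ (d : ι → ℤ) (t : ℤ), b = d + Function.const ι t ∧ 2 * |∑ i, d i| ≤ Fintype.card ι := by
  let t := Int.bdiv (∑ i, b i) (Fintype.card ι)
  have hsum : ∑ i, (b - Function.const ι t) i = Int.bmod (∑ i, b i) (Fintype.card ι) := by
    simp [t, sum_sub_distrib, Int.bmod_eq_self_sub_mul_bdiv]
  refine ⟨b - Function.const ι t, t, (sub_add_cancel _ _).symm, ?_⟩
  rw [hsum]
  rcases (Fintype.card ι).eq_zero_or_pos with h0 | hpos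
  · have := Fintype.card_eq_zero_iff.1 h0
    simp
  · have hlow := Int.le_bmod (x := ∑ i, b i) hpos
    have hup := Int.bmod_lt (x := ∑ i, b i) hpos
    rcases abs_cases (Int.bmod (∑ i, b i) (Fintype.card ι)) with h | h <;> omega

theorem eq_zero_of_sum_sq_eq_zero {b : ι → ℤ} (hb : ∑ i, b i ^ 2 = 0) : b = 0 := by
  rw [sum_eq_zero_iff_of_nonneg fun _ _ => sq_nonneg _] at hb
  exact funext fun i => pow_eq_zero_iff two_ne_zero |>.1 (hb i (mem_univ i))

theorem exists_eq_single_of_sum_sq_eq_one [DecidableEq ι] {b : ι → ℤ} (hb : ∑ i, b i ^ 2 = 1) :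
    ∃ (i₀ : ι) (u : ℤˣ), b = Pi.single i₀ (u : ℤ) := by
  obtain ⟨i₀, hi₀⟩ : ∃ i, b i ≠ 0 := by
    by_contra! hzero
    simp [hzero] at hb
  have hsplit := add_sum_erase univ (fun i => b i ^ 2) (mem_univ i₀)
  have hpos : 0 < b i₀ ^ 2 := by positivity
  have hrest : 0 ≤ ∑ i ∈ univ.erase i₀, b i ^ 2 := sum_nonneg fun _ _ => sq_nonneg _
  have hunit : b i₀ ^ 2 = 1 := by linarith
  have hzero : ∑ i ∈ univ.erase i₀, b i ^ 2 = 0 := by linarith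
  rw [sum_eq_zero_iff_of_nonneg fun _ _ => sq_nonneg _] at hzero
  refine ⟨i₀, (Int.isUnit_iff.2 (sq_eq_one_iff.1 hunit)).unit, funext fun i => ?_⟩
  rcases eq_or_ne i i₀ with rfl | hi
  · simp
  · simpa [hi] using hzero i (mem_erase.2 ⟨hi, mem_univ i⟩)

theorem card_sub_one_le_spread {b : ι → ℤ} (hb : ∀ t, b ≠ Function.const ι t) :
    (Fintype.card ι : ℤ) - 1 ≤ spread b := by
  obtain ⟨d, t, rfl, hd⟩ := exists_eq_add_const_two_mul_abs_sum_le b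
  rw [spread_add_const]
  rcases (abs_nonneg (∑ i, d i)).eq_or_lt with h0 | hpos
  · have hsum : ∑ i, d i = 0 := abs_eq_zero.1 h0.symm
    have hsq : 0 < ∑ i, d i ^ 2 := by
      refine (sum_nonneg fun _ _ => sq_nonneg _).lt_of_ne fun hzero => hb t ?_
      rw [eq_zero_of_sum_sq_eq_zero hzero.symm, zero_add]
    rw [spread, hsum]
    nlinarith
  · have hle := abs_sum_mul_card_sub_abs_sum_le_spread d
    have : 0 ≤ (|∑ i, d i| - 1) * (Fintype.card ι - |∑ i, d i| - 1) :=
      mul_nonneg (by omega) (by omega)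
    linarith

theorem abs_sum_lt_three_of_spread_lt (hι : Fintype.card ι ≠ 6) {d : ι → ℤ}
    (hd : 2 * |∑ i, d i| ≤ Fintype.card ι) (hlt : spread d < 2 * (Fintype.card ι - 1)) :
    |∑ i, d i| < 3 := by
  by_contra! hge
  have hle := abs_sum_mul_card_sub_abs_sum_le_spread d
  have hcard : 7 ≤ (Fintype.card ι : ℤ) := by omega
  have hmono : 3 * ((Fintype.card ι : ℤ) - 3) ≤
      |∑ i, d i| * (Fintype.card ι - |∑ i, d i|) := by
    have : 0 ≤ (|∑ i, d i| - 3) * (Fintype.card ι - |∑ i, d i| - 3) :=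
      mul_nonneg (by omega) (by omega)
    linarith
  linarith

theorem exists_eq_add_const_of_spread_lt [DecidableEq ι] (hι : Fintype.card ι ≠ 6) {b : ι → ℤ}
    (hb : spread b < 2 * (Fintype.card ι - 1)) :
    ∃ (d : ι → ℤ) (t : ℤ), b = d + Function.const ι t ∧
      (d = 0 ∨ (∃ (i₀ : ι) (u : ℤˣ), d = Pi.single i₀ (u : ℤ)) ∨
        4 ≤ Fintype.card ι ∧ |∑ i, d i| = 2) := by
  obtain ⟨d, t, rfl, hd⟩ := exists_eq_add_const_two_mul_abs_sum_le b
  rw [spread_add_const] at hb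
  refine ⟨d, t, rfl, ?_⟩
  have hlt := abs_sum_lt_three_of_spread_lt hι hd hb
  obtain ⟨m, hm⟩ := even_sum_sq_sub_sum d
  have hsq : 0 ≤ ∑ i, d i ^ 2 := sum_nonneg fun _ _ => sq_nonneg _
  rw [spread, ← sq_abs (∑ i, d i)] at hb
  obtain h0 | h1 | h2 : |∑ i, d i| = 0 ∨ |∑ i, d i| = 1 ∨ |∑ i, d i| = 2 := by
    have := abs_nonneg (∑ i, d i)
    omega
  · have hsmall : ∑ i, d i ^ 2 < 2 := by
      rw [h0] at hb
      nlinarith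
    rw [abs_eq_zero] at h0
    exact Or.inl (eq_zero_of_sum_sq_eq_zero (by omega))
  · have hsmall : ∑ i, d i ^ 2 < 2 := by
      rw [h1] at hb
      nlinarith
    rw [abs_eq one_pos.le] at h1
    exact Or.inr (Or.inl (exists_eq_single_of_sum_sq_eq_one (by omega)))
  · exact Or.inr (Or.inr ⟨by omega, h2⟩)

theorem exists_forall_ne_eq_const_of_sum_spread_lt [Nonempty κ] {b : κ → ι → ℤ}
    (hb : ∑ r, spread (b r) < 2 * (Fintype.card ι - 1)) :
    ∃ r₀, ∀ r ≠ r₀, ∃ t, b r = Function.const ι t := by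
  classical
  by_cases hall : ∀ r, ∃ t, b r = Function.const ι t
  · exact ⟨Classical.arbitrary κ, fun r _ => hall r⟩
  push Not at hall
  obtain ⟨r₀, hr₀⟩ := hall
  refine ⟨r₀, fun r hr => ?_⟩
  by_contra! hconst
  have hpair := sum_le_sum_of_subset_of_nonneg (subset_univ {r, r₀})
    (f := fun r => spread (b r)) fun i _ _ => spread_nonneg (b i)
  rw [sum_pair hr] at hpair
  linarith [card_sub_one_le_spread hr₀, card_sub_one_le_spread hconst]

end Spread

section RootsOfUnity

variable {R A : Type*} [CommRing R] [IsDomain R]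

theorem sum_nthRootsFinset_one_eq [AddCommMonoid A] {n : ℕ} {ζ : R} (hζ : IsPrimitiveRoot ζ n)
    (f : R → A) : ∑ η ∈ nthRootsFinset n (1 : R), f η = ∑ i : Fin n, f (ζ ^ (i : ℕ)) := by
  classical
  rw [nthRootsFinset_def, sum_eq_multiset_sum, Multiset.toFinset_val,
    hζ.nthRoots_one_nodup.dedup, hζ.nthRoots_eq (one_pow n),
    Fin.sum_univ_eq_sum_range fun i => f (ζ ^ i)]
  simp [Finset.sum]

theorem sum_primitiveRoots_prime_pow_succ [AddCommGroup A] {p : ℕ} (hp : p.Prime) (m : ℕ)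
    (f : R → A) :
    ∑ η ∈ primitiveRoots (p ^ (m + 1)) R, f η =
      ∑ η ∈ nthRootsFinset (p ^ (m + 1)) (1 : R), f η -
        ∑ η ∈ nthRootsFinset (p ^ m) (1 : R), f η := by
  classical
  have := Fact.mk hp
  have hpos : ∀ k, 0 < p ^ k := fun k => pow_pos hp.pos k
  have hsubset : nthRootsFinset (p ^ m) (1 : R) ⊆ nthRootsFinset (p ^ (m + 1)) (1 : R) := by
    intro η hη
    rw [mem_nthRootsFinset (hpos _)] at hη ⊢
    rw [pow_succ, pow_mul, hη, one_pow]
  have hsdiff : primitiveRoots (p ^ (m + 1)) R =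
      nthRootsFinset (p ^ (m + 1)) (1 : R) \ nthRootsFinset (p ^ m) (1 : R) := by
    ext η
    rw [mem_sdiff, mem_primitiveRoots (hpos _), mem_nthRootsFinset (hpos _),
      mem_nthRootsFinset (hpos _)]
    refine ⟨fun h => ⟨h.pow_eq_one, h.pow_ne_one_of_pos_of_lt (hpos m).ne'
      (Nat.pow_lt_pow_right hp.one_lt m.lt_succ_self)⟩, fun h => ?_⟩
    rw [IsPrimitiveRoot.iff_orderOf]
    exact orderOf_eq_prime_pow h.2 h.1
  rw [hsdiff, sum_sdiff_eq_sub hsubset]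

end RootsOfUnity

section CyclotomicSum

/-- The integral combination `∑ᵢ cᵢ xⁱ` of the powers `1, x, …, xⁿ⁻¹`.  For a root of
unity `ζ` of order `n` this is the general element of `ℤ[ζ]`, and letting `x` run over the primitive
`n`-th roots of unity gives its conjugates. -/
def cyclotomicSum {R : Type*} [Ring R] {n : ℕ} (c : Fin n → ℤ) (x : R) : R :=
  ∑ i, (c i : R) * x ^ (i : ℕ)

/-- The coefficients `c_{r + Mk}`, for `k < q`, of a vector `c` of length `qM`: those of the powers
of `ζ` in the coset of `ζ ^ r` modulo the `q`-th roots of unity, if `ζ` has order `qM`. -/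
def row {q M : ℕ} (c : Fin (q * M) → ℤ) (r : Fin M) : Fin q → ℤ :=
  fun k => c (finProdFinEquiv (k, r))

theorem map_cyclotomicSum {R S : Type*} [Ring R] [Ring S] {n : ℕ} (φ : R →+* S) (c : Fin n → ℤ)
    (x : R) : φ (cyclotomicSum c x) = cyclotomicSum c (φ x) := by
  simp only [cyclotomicSum, map_sum, map_mul, map_pow, map_intCast]

theorem cyclotomicSum_one {R : Type*} [Ring R] {n : ℕ} (c : Fin n → ℤ) :
    cyclotomicSum c (1 : R) = ((∑ i, c i : ℤ) : R) := by
  simp [cyclotomicSum]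

theorem cyclotomicSum_zero {R : Type*} [Ring R] {n : ℕ} (x : R) :
    cyclotomicSum (0 : Fin n → ℤ) x = 0 := by
  simp [cyclotomicSum]

theorem cyclotomicSum_single {R : Type*} [Ring R] {n : ℕ} (i : Fin n) (a : ℤ) (x : R) :
    cyclotomicSum (Pi.single i a) x = a * x ^ (i : ℕ) := by
  rw [cyclotomicSum, Fintype.sum_eq_single i fun j hj => by simp [hj], Pi.single_eq_same]

theorem cyclotomicSum_add_const {R : Type*} [CommRing R] [IsDomain R] {n : ℕ} {ω : R}
    (hω : IsPrimitiveRoot ω n) (hn : 1 < n) (c : Fin n → ℤ) (t : ℤ) :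
    cyclotomicSum (c + Function.const _ t) ω = cyclotomicSum c ω := by
  have hgeom : ∑ i : Fin n, ω ^ (i : ℕ) = 0 := by
    rw [Fin.sum_univ_eq_sum_range fun i => ω ^ i, hω.geom_sum_eq_zero hn]
  simp only [cyclotomicSum, Pi.add_apply, Function.const_apply, Int.cast_add, add_mul,
    sum_add_distrib, ← mul_sum, hgeom, mul_zero, add_zero]

theorem sum_sum_row {A : Type*} [AddCommMonoid A] {q M : ℕ} (c : Fin (q * M) → ℤ) (f : ℤ → A) :
    ∑ r, ∑ k, f (row c r k) = ∑ i, f (c i) := by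
  rw [← finProdFinEquiv.sum_comp, Fintype.sum_prod_type_right]
  rfl

theorem cyclotomicSum_eq_sum_row {R : Type*} [CommRing R] {q M : ℕ} (c : Fin (q * M) → ℤ) (x : R) :
    cyclotomicSum c x = ∑ r : Fin M, x ^ (r : ℕ) * cyclotomicSum (row c r) (x ^ M) := by
  rw [cyclotomicSum, ← finProdFinEquiv.sum_comp, Fintype.sum_prod_type_right]
  refine sum_congr rfl fun r _ => ?_
  rw [cyclotomicSum, mul_sum]
  refine sum_congr rfl fun k _ => ?_
  rw [row, finProdFinEquiv_apply_val, pow_add, pow_mul]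
  ring

theorem cyclotomicSum_of_pow_eq_one {R : Type*} [CommRing R] {q M : ℕ} (c : Fin (q * M) → ℤ) {x : R}
    (hx : x ^ M = 1) : cyclotomicSum c x = cyclotomicSum (fun r : Fin M => ∑ k, row c r k) x := by
  simp only [cyclotomicSum_eq_sum_row c, hx, cyclotomicSum_one]
  exact sum_congr rfl fun r _ => mul_comm _ _

theorem sum_nthRootsFinset_cyclotomicSum_mul {F : Type*} [Field F] {n : ℕ} {ζ : F}
    (hζ : IsPrimitiveRoot ζ n) (c d : Fin n → ℤ) :
    ∑ η ∈ nthRootsFinset n (1 : F), cyclotomicSum c η * cyclotomicSum d η⁻¹ =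
      n * ∑ i, (c i : F) * d i := by
  have orthogonality (i j : Fin n) :
      ∑ η ∈ nthRootsFinset n (1 : F), η ^ (i : ℕ) * η⁻¹ ^ (j : ℕ) =
        if i = j then (n : F) else 0 := by
    have hζ0 : ζ ≠ 0 := hζ.ne_zero i.pos.ne'
    have hpow (k : ℕ) : (ζ ^ k) ^ n = 1 := by rw [pow_right_comm, hζ.pow_eq_one, one_pow]
    have hratio (a : ℕ) : (ζ ^ a) ^ (i : ℕ) * (ζ ^ a)⁻¹ ^ (j : ℕ) =
        (ζ ^ (i : ℕ) / ζ ^ (j : ℕ)) ^ a := by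
      rw [div_pow, inv_pow, pow_right_comm, pow_right_comm ζ a, div_eq_mul_inv]
    simp only [sum_nthRootsFinset_one_eq hζ, hratio]
    rw [Fin.sum_univ_eq_sum_range fun a => (ζ ^ (i : ℕ) / ζ ^ (j : ℕ)) ^ a]
    split_ifs with hij
    · simp [hij, hζ0]
    · have hne : ζ ^ (i : ℕ) / ζ ^ (j : ℕ) ≠ 1 := by
        rw [Ne, div_eq_one_iff_eq (pow_ne_zero _ hζ0)]
        exact fun h => hij (Fin.ext (hζ.pow_inj i.2 j.2 h))
      rw [geom_sum_eq hne, div_pow, hpow, hpow, div_one, sub_self, zero_div]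
  calc ∑ η ∈ nthRootsFinset n (1 : F), cyclotomicSum c η * cyclotomicSum d η⁻¹
      = ∑ i, ∑ j, (c i : F) * d j *
          ∑ η ∈ nthRootsFinset n (1 : F), η ^ (i : ℕ) * η⁻¹ ^ (j : ℕ) := by
        simp only [cyclotomicSum, Fintype.sum_mul_sum]
        simp only [mul_sum, mul_mul_mul_comm]
        rw [sum_comm]
        exact sum_congr rfl fun i _ => sum_comm
    _ = n * ∑ i, (c i : F) * d i := by
        simp only [orthogonality, mul_ite, mul_zero, sum_ite_eq, mem_univ, if_true, mul_sum,
          mul_comm]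

theorem sum_primitiveRoots_cyclotomicSum_mul {F : Type*} [Field F] {p m : ℕ} (hp : p.Prime) {ζ : F}
    (hζ : IsPrimitiveRoot ζ (p * p ^ m)) (c : Fin (p * p ^ m) → ℤ) :
    ∑ η ∈ primitiveRoots (p * p ^ m) F, cyclotomicSum c η * cyclotomicSum c η⁻¹ =
      p ^ m * ((∑ r, spread (row c r) : ℤ) : F) := by
  have hζp : IsPrimitiveRoot (ζ ^ p) (p ^ m) := hζ.pow (mul_pos hp.pos (pow_pos hp.pos m)) rfl
  have hsub : ∑ η ∈ nthRootsFinset (p ^ m) (1 : F), cyclotomicSum c η * cyclotomicSum c η⁻¹ =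
      p ^ m * ∑ r, ((∑ k, row c r k : ℤ) : F) * (∑ k, row c r k : ℤ) := by
    rw [← Nat.cast_pow, ← sum_nthRootsFinset_cyclotomicSum_mul hζp]
    refine sum_congr rfl fun η hη => ?_
    rw [mem_nthRootsFinset (pow_pos hp.pos m)] at hη
    rw [cyclotomicSum_of_pow_eq_one c hη,
      cyclotomicSum_of_pow_eq_one c (by rw [inv_pow, hη, inv_one])]
  have hdiff := sum_primitiveRoots_prime_pow_succ hp m
    fun η : F => cyclotomicSum c η * cyclotomicSum c η⁻¹
  rw [pow_succ'] at hdiff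
  rw [hdiff, hsub, sum_nthRootsFinset_cyclotomicSum_mul hζ,
    ← sum_sum_row c fun a => (a : F) * a]
  simp only [spread, Fintype.card_fin, sum_sub_distrib, ← mul_sum]
  push_cast
  simp only [← sq]
  ring

end CyclotomicSum

section ConjMean

theorem mean_conjugates_mul_finrank {K : Type*} [Field K] [NumberField K] [Algebra K ℂ] (x : K) :
    (conjugates (algebraMap K ℂ x)).sum / (conjugates (algebraMap K ℂ x)).card * finrank ℚ K =
      ∑ σ : K →ₐ[ℚ] ℂ, σ x := by
  have hx : IsIntegral ℚ x := Algebra.IsIntegral.isIntegral x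
  have hconj : conjugates (algebraMap K ℂ x) = (minpoly ℚ x).aroots ℂ := by
    rw [conjugates, minpoly.algebraMap_eq (algebraMap K ℂ).injective x]
  have hsplit : ((minpoly ℚ x).map (algebraMap ℚ ℂ)).Splits := IsAlgClosed.splits _
  have hcard : ((minpoly ℚ x).aroots ℂ).card = (minpoly ℚ x).natDegree := by
    rw [aroots, ← hsplit.natDegree_eq_card_roots, natDegree_map]
  have hdeg : ((minpoly ℚ x).natDegree : ℂ) ≠ 0 := by
    exact_mod_cast (minpoly.natDegree_pos hx).ne'
  rw [← trace_eq_sum_embeddings ℂ (K := ℚ), trace_eq_sum_roots hsplit, hconj, hcard,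
    ← finrank_mul_finrank ℚ (IntermediateField.adjoin ℚ {x}) K,
    IntermediateField.adjoin.finrank hx, nsmul_eq_mul]
  push_cast
  field_simp

theorem conjMean_cyclotomicSum_mul_totient {n : ℕ} [NeZero n] {ζ : ℂ} (hζ : IsPrimitiveRoot ζ n)
    (c : Fin n → ℤ) :
    (conjMean (cyclotomicSum c ζ) : ℂ) * n.totient =
      ∑ η ∈ primitiveRoots n ℂ, cyclotomicSum c η * cyclotomicSum c η⁻¹ := by
  let K := IntermediateField.adjoin ℚ {ζ}
  have hcyc : IsCyclotomicExtension {n} ℚ K :=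
    (IntermediateField.isCyclotomicExtension_singleton_iff_eq_adjoin n ℚ ℂ K hζ).2 rfl
  have : NumberField K := IsCyclotomicExtension.numberField {n} ℚ K
  let z : K := IntermediateField.AdjoinSimple.gen ℚ ζ
  have hzζ : algebraMap K ℂ z = ζ := IntermediateField.AdjoinSimple.algebraMap_gen ℚ ζ
  have hz : IsPrimitiveRoot z n :=
    .of_map_of_injective (f := algebraMap K ℂ) (by rwa [hzζ]) (algebraMap K ℂ).injective
  have hirr : Irreducible (cyclotomic n ℚ) := cyclotomic.irreducible_rat (NeZero.pos n)
  have hmap (φ : K →+* ℂ) : φ (cyclotomicSum c z * cyclotomicSum c z⁻¹) =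
      cyclotomicSum c (φ z) * cyclotomicSum c (φ z)⁻¹ := by
    rw [map_mul, map_cyclotomicSum, map_cyclotomicSum, map_inv₀]
  have hnorm : algebraMap K ℂ (cyclotomicSum c z * cyclotomicSum c z⁻¹) =
      ((‖cyclotomicSum c ζ‖ ^ 2 : ℝ) : ℂ) := by
    rw [hmap, hzζ, Complex.inv_eq_conj (hζ.norm'_eq_one (NeZero.ne n)), ← map_cyclotomicSum,
      Complex.mul_conj', Complex.ofReal_pow]
  rw [ofReal_conjMean, ← hnorm, ← IsCyclotomicExtension.finrank K hirr, mean_conjugates_mul_finrank,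
    ← sum_coe_sort (primitiveRoots n ℂ)]
  exact Fintype.sum_equiv (hz.embeddingsEquivPrimitiveRoots ℂ hirr) _ _ fun σ => hmap σ

theorem conjMean_cyclotomicSum_mul_sub_one {p m : ℕ} (hp : p.Prime) {ζ : ℂ}
    (hζ : IsPrimitiveRoot ζ (p * p ^ m)) (c : Fin (p * p ^ m) → ℤ) :
    conjMean (cyclotomicSum c ζ) * (p - 1) = ∑ r, spread (row c r) := by
  have : NeZero (p * p ^ m) := ⟨mul_ne_zero hp.ne_zero (pow_ne_zero m hp.ne_zero)⟩
  have hmean := conjMean_cyclotomicSum_mul_totient hζ c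
  have htotient : (p * p ^ m).totient = p ^ m * (p - 1) := by
    rw [← pow_succ', Nat.totient_prime_pow_succ hp]
  rw [sum_primitiveRoots_cyclotomicSum_mul hp hζ, htotient, Nat.cast_mul, Nat.cast_pow,
    Nat.cast_sub hp.one_le, Nat.cast_one, mul_left_comm] at hmean
  have hpm : (p : ℂ) ^ m ≠ 0 := pow_ne_zero m (Nat.cast_ne_zero.2 hp.ne_zero)
  exact_mod_cast mul_left_cancel₀ hpm hmean

end ConjMean

section ConstantRows

variable {q M : ℕ} {c : Fin (q * M) → ℤ} {r₀ : Fin M} {d : Fin q → ℤ} {t : ℤ}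

theorem cyclotomicSum_eq_of_row_eq_const {R : Type*} [CommRing R] [IsDomain R] {ζ : R}
    (hζ : IsPrimitiveRoot (ζ ^ M) q) (hq : 1 < q)
    (hconst : ∀ r ≠ r₀, ∃ s, row c r = Function.const _ s)
    (hr₀ : row c r₀ = d + Function.const _ t) :
    cyclotomicSum c ζ = ζ ^ (r₀ : ℕ) * cyclotomicSum d (ζ ^ M) := by
  rw [cyclotomicSum_eq_sum_row, Fintype.sum_eq_single r₀, hr₀, cyclotomicSum_add_const hζ hq]
  intro r hr
  obtain ⟨s, hs⟩ := hconst r hr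
  rw [hs, ← zero_add (Function.const _ s), cyclotomicSum_add_const hζ hq, cyclotomicSum_zero,
    mul_zero]

theorem sum_modEq_of_row_eq_const (hconst : ∀ r ≠ r₀, ∃ s, row c r = Function.const _ s)
    (hr₀ : row c r₀ = d + Function.const _ t) : ∑ i, c i ≡ ∑ k, d k [ZMOD q] := by
  rw [← ZMod.intCast_eq_intCast_iff, Int.cast_sum, Int.cast_sum,
    ← sum_sum_row c fun a => (a : ZMod q)]
  rw [Fintype.sum_eq_single r₀, hr₀]
  · simp [sum_add_distrib]
  · intro r hr
    obtain ⟨s, hs⟩ := hconst r hr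
    simp [hs]

end ConstantRows

theorem cyclotomicSum_eq_zero_or_isOfFinOrder_or_two_le_conjMean {p m : ℕ} (hp : p.Prime) {ζ : ℂ}
    (hζ : IsPrimitiveRoot ζ (p * p ^ m)) (c : Fin (p * p ^ m) → ℤ)
    (h : p = 2 ∨ ¬ ∑ i, c i ≡ 2 [ZMOD p] ∧ ¬ ∑ i, c i ≡ -2 [ZMOD p]) :
    cyclotomicSum c ζ = 0 ∨ IsOfFinOrder (cyclotomicSum c ζ) ∨
      2 ≤ conjMean (cyclotomicSum c ζ) := by
  have hN : 0 < p * p ^ m := mul_pos hp.pos (pow_pos hp.pos m)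
  have hω : IsPrimitiveRoot (ζ ^ p ^ m) p := hζ.pow hN (mul_comm _ _)
  have hζfin : IsOfFinOrder ζ := isOfFinOrder_iff_pow_eq_one.2 ⟨_, hN, hζ.pow_eq_one⟩
  have : Nonempty (Fin (p ^ m)) := ⟨⟨0, pow_pos hp.pos m⟩⟩
  rcases le_or_gt 2 (conjMean (cyclotomicSum c ζ)) with hmean | hmean
  · exact Or.inr (Or.inr hmean)
  have hspread : ∑ r, spread (row c r) < 2 * ((Fintype.card (Fin p) : ℤ) - 1) := by
    have hp1 : (0 : ℝ) < p - 1 := sub_pos.2 (Nat.one_lt_cast.2 hp.one_lt)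
    have := mul_lt_mul_of_pos_right hmean hp1
    rw [conjMean_cyclotomicSum_mul_sub_one hp hζ] at this
    rw [Fintype.card_fin]
    exact_mod_cast this
  obtain ⟨r₀, hconst⟩ := exists_forall_ne_eq_const_of_sum_spread_lt hspread
  have hp6 : Fintype.card (Fin p) ≠ 6 := by
    rw [Fintype.card_fin]
    rintro rfl
    norm_num at hp
  obtain ⟨d, t, hr₀, hd⟩ := exists_eq_add_const_of_spread_lt hp6
    ((single_le_sum (fun r _ => spread_nonneg (row c r)) (mem_univ r₀)).trans_lt hspread)
  rw [cyclotomicSum_eq_of_row_eq_const hω hp.one_lt hconst hr₀]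
  rcases hd with rfl | ⟨k, u, rfl⟩ | ⟨hp4, hd⟩
  · exact Or.inl (by rw [cyclotomicSum_zero, mul_zero])
  · have hu : IsOfFinOrder ((u : ℤ) : ℂ) :=
      ((Int.castRingHom ℂ : ℤ →* ℂ).comp (Units.coeHom ℤ)).isOfFinOrder (isOfFinOrder_of_finite u)
    rw [cyclotomicSum_single]
    exact Or.inr (Or.inl (hζfin.pow.mul (hu.mul hζfin.pow.pow)))
  · rw [Fintype.card_fin] at hp4
    have hmod := sum_modEq_of_row_eq_const hconst hr₀
    obtain ⟨hpos, hneg⟩ := h.resolve_left (by omega)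
    rcases (abs_eq zero_le_two).1 hd with hd | hd <;> rw [hd] at hmod <;> contradiction

theorem exists_trace_eq_cyclotomicSum {F V : Type*} [Field F] [IsAlgClosed F] [AddCommGroup V]
    [Module F V] [FiniteDimensional F V] {n : ℕ} (hn : 0 < n) {ζ : F} (hζ : IsPrimitiveRoot ζ n)
    {f : End F V} (hf : f ^ n = 1) :
    ∃ c : Fin n → ℤ, ∑ i, c i = finrank F V ∧ LinearMap.trace F V f = cyclotomicSum c ζ := by
  classical
  let s := f.charpoly.roots
  have hsplit := IsAlgClosed.splits f.charpoly
  have hs : ∀ x ∈ s, x ∈ nthRootsFinset n (1 : F) := by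
    intro x hx
    obtain ⟨v, hv⟩ := ((End.hasEigenvalue_iff_isRoot_charpoly f x).2
      (isRoot_of_mem_roots hx)).exists_hasEigenvector
    have hpow : x ^ n • v = (1 : F) • v := by rw [← hv.pow_apply, hf, End.one_apply, one_smul]
    rw [mem_nthRootsFinset hn]
    exact smul_left_injective F hv.2 hpow
  refine ⟨fun i => s.count (ζ ^ (i : ℕ)), ?_, ?_⟩
  · rw [← sum_nthRootsFinset_one_eq hζ fun x => (s.count x : ℤ), ← Nat.cast_sum,
      Multiset.sum_count_eq_card hs, ← hsplit.natDegree_eq_card_roots,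
      LinearMap.charpoly_natDegree]
  · rw [End.trace_eq_sum_roots_charpoly_of_splits hsplit,
      sum_multiset_count_of_subset s _ fun x hx => hs x (Multiset.mem_toFinset.1 hx),
      sum_nthRootsFinset_one_eq hζ fun x => s.count x • x]
    simp [cyclotomicSum, s]

theorem theorem4_general {G V : Type*} [Monoid G] [AddCommGroup V] [Module ℂ V]
    [FiniteDimensional ℂ V] (ρ : Representation ℂ G V) {p : ℕ} (hp : p.Prime) {g : G}
    (hg : ∃ n : ℕ, orderOf g = p ^ n)
    (h : p = 2 ∨ ¬ (finrank ℂ V : ℤ) ≡ 2 [ZMOD p] ∧ ¬ (finrank ℂ V : ℤ) ≡ -2 [ZMOD p]) :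
    ρ.character g = 0 ∨ (∃ k : ℕ, 0 < k ∧ ρ.character g ^ k = 1) ∨
      2 ≤ conjMean (ρ.character g) := by
  obtain ⟨m, hm⟩ := hg
  have hN : 0 < p * p ^ m := mul_pos hp.pos (pow_pos hp.pos m)
  have hζ := Complex.isPrimitiveRoot_exp (p * p ^ m) hN.ne'
  have hpow : ρ g ^ (p * p ^ m) = 1 := by
    rw [← map_pow, mul_comm, pow_mul, ← hm, pow_orderOf_eq_one, one_pow, map_one]
  obtain ⟨c, hdim, htrace⟩ := exists_trace_eq_cyclotomicSum hN hζ hpow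
  rw [← isOfFinOrder_iff_pow_eq_one, Representation.character, htrace]
  rw [← hdim] at h
  exact cyclotomicSum_eq_zero_or_isOfFinOrder_or_two_le_conjMean hp hζ c h

theorem theorem4 (G : Type*) [Group G] [Finite G] (χ : G → ℂ) (hχ : χ ∈ Irr G)
    (p : ℕ) (hp : p.Prime) (g : G) (hg : ∃ n : ℕ, orderOf g = p ^ n)
    (h : p = 2 ∨ ∀ d : ℤ, χ 1 = (d : ℂ) → ¬ d ≡ 2 [ZMOD p] ∧ ¬ d ≡ -2 [ZMOD p]) :
    χ g = 0 ∨ (∃ k : ℕ, 0 < k ∧ χ g ^ k = 1) ∨ 2 ≤ conjMean (χ g) := by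
  obtain ⟨n, ρ, -, rfl⟩ := hχ
  refine theorem4_general ρ hp hg (h.imp_right fun h => h _ ?_)
  rw [Representation.char_one, Int.cast_natCast]
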